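/- An $s$-$t$ graph is an undirected graph $G$ with edge lengths $\mathsf{len}_G \ge 0$ and two distinguished vertices $s(G) \neq t(G)$; $d_G$ denotes its shortest-path metric. For $s$-$t$ graphs $H$ and $G$, the graph $H \oslash G$ is obtained from $H$ by replacing every edge $e=(u,v)$ of $H$ (with an arbitrarily chosen orientation) by a copy of $G$, with $s(G)$ identified with $u$ and $t(G)$ with $v$, and with the lengths of the copy multiplied by $\mathsf{len}_H(e)/d_G(s(G),t(G))$; its distinguished vertices are $s(H)$ and $t(H)$. Let $G^{\oslash 0}$ be a single edge of length $1$ joining $s$ and $t$, and let $G^{\oslash k} = G^{\oslash (k-1)} \oslash G$ for $k \ge 1$. The complete bipartite graph $K_{2,n}$ is regarded as an $s$-$t$ graph with unit edge lengths, whose distinguished vertices are the two vertices of the side of size $2$. For a map $f$ between metric spaces let $\|f\|_{\mathrm{Lip}} = \sup_{x \ne y} d(f(x),f(y))/d(x,y)$; the distortion of an injective map $f : X \to Y$ is $\|f\|_{\mathrm{Lip}} \cdot \|f^{-1}\|_{\mathrm{Lip}}$, where $f^{-1} : f(X) \to X$. For a metric space $X$ let $c_1(X)$ be the infimum of the distortions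 of the injective maps $f : X \to L_1([0,1])$, and let $c_1(K_{2,n}^{\oslash k})$ be the value of $c_1$ for the vertex set of $K_{2,n}^{\oslash k}$ with its shortest-path metric. **Theorem.** For all integers $n \ge 1$ and $k \ge 0$, $$c_1\bigl(K_{2,n}^{\oslash k}\bigr) \le 2 - \frac{2}{2\lceil n/2\rceil + 1}.$$ -/

import Mathlib

open scoped NNReal ENNReal
open MeasureTheory

/-- An `s`-`t` graph with a length function. The graph is undirected; `E` is its set of edges,
and each edge `e` joins `src e` and `tgt e`. The order of the two endpoints only records the
arbitrary orientation that is used to substitute a graph for an edge in `STGraph.comp`. -/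
structure STGraph where
  V : Type
  E : Type
  src : E → V
  tgt : E → V
  len : E → ℝ≥0
  s : V
  t : V
  s_ne_t : s ≠ t

namespace STGraph

/-- `G.HasWalk u v ℓ`: there is a walk from `u` to `v` in `G` of total length `ℓ`.
Edges may be traversed in both directions. -/
inductive HasWalk (G : STGraph) : G.V → G.V → ℝ≥0 → Prop
  | nil (u : G.V) : HasWalk G u u 0
  | forward (e : G.E) {v : G.V} {l : ℝ≥0} :
      HasWalk G (G.tgt e) v l → HasWalk G (G.src e) v (G.len e + l)
  | backward (e : G.E) {v : G.V} {l : ℝ≥0} :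
      HasWalk G (G.src e) v l → HasWalk G (G.tgt e) v (G.len e + l)

theorem HasWalk.append {G : STGraph} {u v w : G.V} {a b : ℝ≥0} (h : G.HasWalk u v a)
    (h' : G.HasWalk v w b) : G.HasWalk u w (a + b) := by
  induction h with
  | nil u => simpa using h'
  | forward e _ ih => rw [add_assoc]; exact .forward e (ih h')
  | backward e _ ih => rw [add_assoc]; exact .backward e (ih h')

theorem HasWalk.reverse {G : STGraph} {u v : G.V} {a : ℝ≥0} (h : G.HasWalk u v a) :
    G.HasWalk v u a := by
  induction h with
  | nil u => exact .nil u
  | forward e _ ih =>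
    have := ih.append (.backward e (.nil _))
    rwa [add_zero, add_comm] at this
  | backward e _ ih =>
    have := ih.append (.forward e (.nil _))
    rwa [add_zero, add_comm] at this

/-- The shortest-path distance `d_len(u,v)`: the infimum of the lengths of the walks from `u` to
`v` (it is `∞` if there is none). -/
noncomputable def pathDist (G : STGraph) (u v : G.V) : ℝ≥0∞ :=
  ⨅ (l : ℝ≥0) (_ : G.HasWalk u v l), (l : ℝ≥0∞)

theorem pathDist_le {G : STGraph} {u v : G.V} {l : ℝ≥0} (h : G.HasWalk u v l) :
    G.pathDist u v ≤ l :=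
  iInf₂_le l h

/-- The shortest-path (semi-)metric on the vertex set of `G`. -/
noncomputable instance (G : STGraph) : PseudoEMetricSpace G.V where
  edist := G.pathDist
  edist_self u := le_antisymm (by simpa using pathDist_le (HasWalk.nil u)) bot_le
  edist_comm u v :=
    le_antisymm (le_iInf₂ fun _ h => pathDist_le h.reverse)
      (le_iInf₂ fun _ h => pathDist_le h.reverse)
  edist_triangle u v w := by
    refine ENNReal.le_iInf₂_add_iInf₂ fun a ha b hb => ?_
    exact_mod_cast pathDist_le (ha.append hb)

/-- The vertices of `H ⊘ G`: the vertices of `H`, and, for every edge of `H`, a copy of every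
vertex of `G` other than `s(G)` and `t(G)`. -/
abbrev CompV (H G : STGraph) : Type :=
  H.V ⊕ (H.E × {v : G.V // v ≠ G.s ∧ v ≠ G.t})

open Classical in
/-- The copy of the vertex `v` of `G` in the copy of `G` that replaces the edge `e` of `H`:
`s(G)` and `t(G)` are identified with the endpoints of `e`. -/
noncomputable def copyVertex (H G : STGraph) (e : H.E) (v : G.V) : CompV H G :=
  if hs : v = G.s then Sum.inl (H.src e)
  else if ht : v = G.t then Sum.inl (H.tgt e)
  else Sum.inr (e, ⟨v, hs, ht⟩)

/-- The composition `H ⊘ G`: every edge `e` of `H` is replaced by a copy of `G`, with the lengths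
of that copy scaled by `len_H(e) / d_G(s(G), t(G))`. -/
noncomputable def comp (H G : STGraph) : STGraph where
  V := CompV H G
  E := H.E × G.E
  src p := copyVertex H G p.1 (G.src p.2)
  tgt p := copyVertex H G p.1 (G.tgt p.2)
  len p := H.len p.1 / (edist G.s G.t).toNNReal * G.len p.2
  s := Sum.inl H.s
  t := Sum.inl H.t
  s_ne_t h := H.s_ne_t (Sum.inl_injective h)

/-- A single edge of unit length, with endpoints `s` and `t`. -/
def singleEdge : STGraph where
  V := Fin 2
  E := Unit
  src _ := 0
  tgt _ := 1
  len _ := 1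
  s := 0
  t := 1
  s_ne_t := by decide

/-- The recursive composition: `G^{⊘0}` is a single edge, and `G^{⊘(k+1)} = G^{⊘k} ⊘ G`. -/
noncomputable def opow (G : STGraph) : ℕ → STGraph
  | 0 => singleEdge
  | k + 1 => (opow G k).comp G

/-- The complete bipartite graph `K_{2,n}` with unit lengths: `s` and `t` are the two vertices of
the side `Fin 2`. Every `i : Fin n` is joined to `s` by the edge `Sum.inl i` and to `t` by the edge
`Sum.inr i`. -/
def K2 (n : ℕ) : STGraph where
  V := Fin 2 ⊕ Fin n
  E := Fin n ⊕ Fin n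
  src := Sum.elim (fun _ => Sum.inl 0) (fun i => Sum.inr i)
  tgt := Sum.elim (fun i => Sum.inr i) (fun _ => Sum.inl 1)
  len _ := 1
  s := Sum.inl 0
  t := Sum.inl 1
  s_ne_t := by simp

end STGraph

/-- `‖f‖_Lip = sup_{x ≠ y} d(f x, f y) / d(x, y)`. -/
noncomputable def lipNorm {X Y : Type*} [PseudoEMetricSpace X] [PseudoEMetricSpace Y]
    (f : X → Y) : ℝ≥0∞ :=
  ⨆ (x : X) (y : X) (_ : x ≠ y), edist (f x) (f y) / edist x y

/-- The distortion `‖f‖_Lip · ‖f⁻¹‖_Lip` of an injective map `f`, where `f⁻¹ : f(X) → X`. -/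
noncomputable def distortion {X Y : Type*} [PseudoEMetricSpace X] [PseudoEMetricSpace Y]
    (f : X → Y) (hf : Function.Injective f) : ℝ≥0∞ :=
  lipNorm f * lipNorm (Equiv.ofInjective f hf).symm

/-- The Banach space `L₁ = L₁([0,1])` of integrable real functions. -/
abbrev L1 : Type :=
  Lp ℝ 1 ((volume : Measure ℝ).restrict (Set.Icc 0 1))

/-- `c₁(X)`: the least distortion required to embed `X` into `L₁`. -/
noncomputable def c1 (X : Type*) [PseudoEMetricSpace X] : ℝ≥0∞ :=
  ⨅ (f : X → L1) (hf : Function.Injective f), distortion f hf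

/-!
The embedding is a random two-colouring of the vertices, built along the recursion: in the step from
`H` to `H ⊘ K_{2,n}`, each midpoint of an edge of `H` gets the colour of one of the endpoints of the
edge. With `m = ⌈n/2⌉`, the choice is made by a random balanced colouring of `2 m` points, among
them the `n` midpoints. One balanced colouring serves all edges, but for each edge a fair coin of
its own decides whether the colouring is reversed; this makes the choices at two different edges
independent. Two midpoints of an edge whose endpoints have different colours are then separated with
probability `θ = m / (2 m - 1)` (`exists_balanced_colouring`). Let `D x y` be the probability that
`x` and `y` are separated. Only finitely many equally likely colourings occur, so `D` embeds
isometrically into `L₁` (`IsCutMetric.exists_L1`), and `D` agrees with the length on each edge, so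
it is at most the shortest-path distance `d`.

For the lower bound on `D`, call each copy of a power of `K_{2,n}` that replaces an edge of a
coarser graph a block, with the endpoints of that edge as its bottom and its top. Two points of a
common `s`-`t` geodesic satisfy `D = d`. Otherwise, they lie at relative heights `α` and `β` on
different branches of a block of some height `L`. Then `d ≤ L * min (α + β) (2 - α - β)`, by the
paths through the bottom and the top of the block, and `D = L * branchSep θ α β`, since the bottom
and the top of the block are separated with probability `L`, and on the half of a branch whose ends
are then separated, the colour changes at a uniformly distributed height. The elementary estimate
`le_branchSep` gives `D ≥ (1 - 1 / (4 θ)) d`, and `1 / (1 - 1 / (4 θ)) = 4 m / (2 m + 1) = 2 - 2 /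
(2 m + 1)`.

The description of the pairs of points is proved by induction, for pairs of edges (`IsMonotoneCut`).
Passing to midpoints is harmless since the values of `D` at the new points are averages of old
values (`IsCutMetric.subdivide`), `branchSep` is affine in each height as long as the height stays
in one half of the block (`InHalf.branchSep_mid_left`), and only upper bounds on `d`, that is,
explicit walks, are needed.
-/

/-! ### Cut metrics and their extension to subdivided edges -/

/-- The discrete distance of two colours. -/
def colourDist (a b : Bool) : ℝ := if a = b then 0 else 1

/-- `D` is the separation probability of a random two-colouring of `V`, drawn uniformly from a
finite family: `D x y` is the probability that `x` and `y` get different colours. -/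
def IsCutMetric {V : Type} (D : V → V → ℝ) : Prop :=
  ∃ (Ω : Type) (_ : Fintype Ω) (_ : Nonempty Ω) (S : Ω → V → Bool),
    ∀ x y, D x y = (∑ ω, colourDist (S ω x) (S ω y)) / Fintype.card Ω

namespace IsCutMetric

variable {V : Type} {D : V → V → ℝ}

theorem self (h : IsCutMetric D) (x : V) : D x x = 0 := by
  obtain ⟨Ω, _, _, S, hS⟩ := h
  simp [hS, colourDist]

theorem symm (h : IsCutMetric D) (x y : V) : D x y = D y x := by
  obtain ⟨Ω, _, _, S, hS⟩ := h
  simp only [hS, colourDist, eq_comm]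

theorem nonneg (h : IsCutMetric D) (x y : V) : 0 ≤ D x y := by
  obtain ⟨Ω, _, _, S, hS⟩ := h
  rw [hS]
  exact div_nonneg (Finset.sum_nonneg fun ω _ => by
    unfold colourDist; split_ifs <;> norm_num) (Nat.cast_nonneg _)

theorem triangle (h : IsCutMetric D) (x y z : V) : D x z ≤ D x y + D y z := by
  obtain ⟨Ω, _, _, S, hS⟩ := h
  simp only [hS]
  rw [← add_div, ← Finset.sum_add_distrib]
  refine div_le_div_of_nonneg_right (Finset.sum_le_sum fun ω _ => ?_) (Nat.cast_nonneg _)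
  cases S ω x <;> cases S ω y <;> cases S ω z <;> norm_num [colourDist]

end IsCutMetric

/-- A uniformly random balanced colouring of `2 m` points separates any two of them with
probability `m / (2 m - 1)`: by symmetry this is the fraction of the pairs that one balanced
colouring separates. -/
theorem exists_balanced_colouring (m : ℕ) (hm : 1 ≤ m) :
    ∃ (C : Type) (_ : Fintype C) (_ : Nonempty C) (c : C → Fin m ⊕ Fin m → Bool),
      ∀ i j, i ≠ j → (∑ σ, colourDist (c σ i) (c σ j)) =
        (m / (2 * m - 1) : ℝ) * Fintype.card C := by
  classical
  let J := Fin m ⊕ Fin m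
  let c : Equiv.Perm J → J → Bool := fun σ i => (σ i).isLeft
  refine ⟨Equiv.Perm J, inferInstance, inferInstance, c, fun i j hij => ?_⟩
  set h : J → J → ℝ := fun a b => ∑ σ : Equiv.Perm J, colourDist (c σ a) (c σ b) with hh
  change h i j = _
  have hsymm : ∀ a b, a ≠ b → h a b = h i j := by
    intro a b hab
    let τ : Equiv.Perm J := Equiv.swap (Equiv.swap a i b) j * Equiv.swap a i
    have hb : Equiv.swap a i b ≠ i := fun h => hab <| by
      have := (Equiv.swap a i).injective (h.trans (Equiv.swap_apply_left a i).symm)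
      exact this.symm
    have ha : τ a = i := by
      simp only [τ, Equiv.Perm.mul_apply, Equiv.swap_apply_left]
      exact Equiv.swap_apply_of_ne_of_ne hb.symm hij
    have hb' : τ b = j := by simp [τ]
    rw [← ha, ← hb']
    simp only [hh]
    refine (Fintype.sum_equiv (Equiv.mulRight τ) _ _ fun σ => ?_).symm
    simp only [c, Equiv.coe_mulRight, Equiv.Perm.mul_apply]
  have hdiag : ∀ a, h a a = 0 := fun a => by simp [hh, colourDist]
  have hrow : ∀ a, ∑ b, h a b = (2 * m - 1) * h i j := by
    intro a
    rw [← Finset.add_sum_erase _ _ (Finset.mem_univ a), hdiag, zero_add,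
      Finset.sum_congr rfl fun b hb => hsymm a b (Finset.ne_of_mem_erase hb).symm,
      Finset.sum_const, Finset.card_erase_of_mem (Finset.mem_univ a), nsmul_eq_mul,
      Finset.card_univ, Nat.cast_sub (Fintype.card_pos_iff.2 ⟨a⟩)]
    simp [J, two_mul]
  have htotal : ∑ a, ∑ b, h a b = 2 * m * ((2 * m - 1) * h i j) := by
    simp only [hrow]
    simp [J, two_mul]
  have hpoint : ∀ σ : Equiv.Perm J,
      ∑ a, ∑ b, colourDist (c σ a) (c σ b) = 2 * m ^ 2 := by
    intro σ
    have h1 : ∀ a, ∑ b, colourDist (c σ a) (c σ b) =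
        ∑ b : J, colourDist (σ a).isLeft b.isLeft := fun a =>
      Fintype.sum_equiv σ _ _ fun b => rfl
    simp only [h1]
    rw [Fintype.sum_equiv σ _ (fun a : J => ∑ b : J, colourDist a.isLeft b.isLeft)
      fun a => rfl]
    simp [J, Fintype.sum_sum_type, colourDist]
    ring
  have htotal' : ∑ a, ∑ b, h a b = Fintype.card (Equiv.Perm J) * (2 * m ^ 2) := by
    simp only [hh]
    rw [Finset.sum_congr rfl fun a _ => Finset.sum_comm, Finset.sum_comm]
    simp only [hpoint]
    simp
  have hm' : (1 : ℝ) ≤ m := by exact_mod_cast hm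
  have h2 : (2 * m - 1 : ℝ) ≠ 0 := by linarith
  have h3 : (m : ℝ) ≠ 0 := by linarith
  rw [htotal] at htotal'
  have : (2 * m : ℝ) * ((2 * m - 1) * h i j) = (2 * m) * (m * Fintype.card (Equiv.Perm J)) := by
    rw [htotal']; ring
  have := mul_left_cancel₀ (by positivity) this
  rw [div_mul_eq_mul_div, eq_div_iff h2]
  linarith

/-- Reversing the bit of `e`. -/
def flipBit {E : Type} [DecidableEq E] (e : E) : (E → Bool) ≃ (E → Bool) :=
  Function.Involutive.toPerm (fun φ => Function.update φ e (!φ e)) fun φ => by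
    simp

theorem flipBit_self {E : Type} [DecidableEq E] (e : E) (φ : E → Bool) :
    flipBit e φ e = !φ e := by
  change Function.update φ e (!φ e) e = _
  simp

theorem flipBit_of_ne {E : Type} [DecidableEq E] {e e' : E} (h : e' ≠ e) (φ : E → Bool) :
    flipBit e φ e' = φ e' := by
  change Function.update φ e (!φ e) e' = _
  simp [h]

/-- Subdivide each edge `e` by the points `(e, i)`, `i : I`, and give `(e, i)` the colour of one
of the endpoints of `e`. Which one is decided by a balanced random colouring of `I`, reversed by a
fair coin that is independent for each edge. The separation probabilities of the extended random
colouring are then the averages of the old ones, except for two points of the same edge. -/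
theorem IsCutMetric.subdivide {V E I : Type} [Finite E] {D : V → V → ℝ} (hD : IsCutMetric D)
    (src tgt : E → V) {m : ℕ} (hm : 1 ≤ m) (ι : I ↪ Fin m ⊕ Fin m) :
    ∃ D' : V ⊕ E × I → V ⊕ E × I → ℝ, IsCutMetric D' ∧
      (∀ u v, D' (.inl u) (.inl v) = D u v) ∧
      (∀ u e i, D' (.inl u) (.inr (e, i)) = (D u (src e) + D u (tgt e)) / 2) ∧
      (∀ e e' i j, e ≠ e' → D' (.inr (e, i)) (.inr (e', j)) =
        (D (src e) (src e') + D (src e) (tgt e') + D (tgt e) (src e') + D (tgt e) (tgt e')) / 4) ∧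
      (∀ e i j, i ≠ j → D' (.inr (e, i)) (.inr (e, j)) =
        m / (2 * m - 1) * D (src e) (tgt e)) := by
  classical
  have := Fintype.ofFinite E
  obtain ⟨Ω, _, _, S, hS⟩ := hD
  obtain ⟨C, _, _, c, hc⟩ := exists_balanced_colouring m hm
  let R := C × (E → Bool)
  let T : Ω × R → V ⊕ E × I → Bool := fun ω x => match x with
    | .inl v => S ω.1 v
    | .inr (e, i) => cond ((ω.2.2 e).xor (c ω.2.1 (ι i))) (S ω.1 (src e)) (S ω.1 (tgt e))
  let d : Ω → V → V → ℝ := fun ω x y => colourDist (S ω x) (S ω y)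
  have hDd : ∀ x y, D x y = (∑ ω, d ω x y) / Fintype.card Ω := hS
  have hΩ : (Fintype.card Ω : ℝ) ≠ 0 := by exact_mod_cast Fintype.card_ne_zero
  have hR : (Fintype.card R : ℝ) ≠ 0 := by exact_mod_cast Fintype.card_ne_zero
  have hcard : (Fintype.card (Ω × R) : ℝ) = Fintype.card Ω * Fintype.card R := by
    rw [Fintype.card_prod]; push_cast; ring
  have hsum : ∀ f : Ω → ℝ, ∑ ω : Ω × R, f ω.1 = Fintype.card R * ∑ ω, f ω := by
    intro f
    rw [Fintype.sum_prod_type, Finset.mul_sum]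
    simp
  -- the coin of `e` is fair, so the average is unchanged when it is reversed
  have hflip : ∀ (e : E) (f : Ω × R → ℝ),
      ∑ ω, f ω = ∑ ω : Ω × R, f (ω.1, ω.2.1, flipBit e ω.2.2) := by
    intro e f
    refine (Fintype.sum_equiv ((Equiv.refl Ω).prodCongr ((Equiv.refl C).prodCongr (flipBit e)))
      _ _ fun ω => rfl).symm
  refine ⟨fun x y => (∑ ω, colourDist (T ω x) (T ω y)) / Fintype.card (Ω × R),
    ⟨Ω × R, inferInstance, inferInstance, T, fun x y => rfl⟩, ?_, ?_, ?_, ?_⟩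
  · intro u v
    have : ∑ ω, (colourDist (T ω (.inl u)) (T ω (.inl v))) =
        Fintype.card R * ∑ ω, d ω u v := hsum fun ω => d ω u v
    simp only [this, hcard, hDd]
    field_simp
  · intro u e i
    set f : Ω × R → ℝ := fun ω => colourDist (T ω (.inl u)) (T ω (.inr (e, i))) with hf
    have : 2 * ∑ ω, f ω =
        Fintype.card R * ((∑ ω, d ω u (src e)) + ∑ ω, d ω u (tgt e)) := by
      rw [← Finset.sum_add_distrib, ← hsum fun ω => d ω u (src e) + d ω u (tgt e), two_mul]
      nth_rewrite 2 [hflip e f]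
      rw [← Finset.sum_add_distrib]
      refine Finset.sum_congr rfl fun ω _ => ?_
      simp only [hf, T, d, flipBit_self]
      cases ω.2.2 e <;> cases c ω.2.1 (ι i) <;> simp [add_comm]
    change (∑ ω, f ω) / _ = _
    simp only [hcard, hDd]
    field_simp
    linarith
  · intro e e' i j hee
    set f : Ω × R → ℝ := fun ω => colourDist (T ω (.inr (e, i))) (T ω (.inr (e', j))) with hf
    have : 4 * ∑ ω, f ω = Fintype.card R * ((∑ ω, d ω (src e) (src e')) +
        (∑ ω, d ω (src e) (tgt e')) + (∑ ω, d ω (tgt e) (src e')) +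
          ∑ ω, d ω (tgt e) (tgt e')) := by
      rw [← Finset.sum_add_distrib, ← Finset.sum_add_distrib, ← Finset.sum_add_distrib,
        ← hsum fun ω => d ω (src e) (src e') + d ω (src e) (tgt e') + d ω (tgt e) (src e') +
          d ω (tgt e) (tgt e')]
      have h4 : 4 * ∑ ω, f ω = (∑ ω, f ω) + (∑ ω : Ω × R, f (ω.1, ω.2.1, flipBit e ω.2.2)) +
          ((∑ ω : Ω × R, f (ω.1, ω.2.1, flipBit e' ω.2.2)) +
            ∑ ω : Ω × R, f (ω.1, ω.2.1, flipBit e' (flipBit e ω.2.2))) := by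
        rw [← hflip e f, ← hflip e' f,
          ← hflip e fun ω => f (ω.1, ω.2.1, flipBit e' ω.2.2), ← hflip e' f]
        ring
      rw [h4, ← Finset.sum_add_distrib, ← Finset.sum_add_distrib, ← Finset.sum_add_distrib]
      refine Finset.sum_congr rfl fun ω _ => ?_
      simp only [hf, T, d, flipBit_self, flipBit_of_ne hee, flipBit_of_ne hee.symm]
      cases ω.2.2 e <;> cases ω.2.2 e' <;> cases c ω.2.1 (ι i) <;> cases c ω.2.1 (ι j) <;>
        simp <;> ring
    change (∑ ω, f ω) / _ = _
    simp only [hcard, hDd]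
    field_simp
    linarith
  · intro e i j hij
    set f : Ω × R → ℝ := fun ω => colourDist (T ω (.inr (e, i))) (T ω (.inr (e, j))) with hf
    have : ∑ ω, f ω = (m / (2 * m - 1) * Fintype.card R) * ∑ ω, d ω (src e) (tgt e) := by
      have hpt : ∀ ω, f ω = d ω.1 (src e) (tgt e) *
          colourDist (c ω.2.1 (ι i)) (c ω.2.1 (ι j)) := by
        intro ω
        simp only [hf, T, d]
        cases ω.2.2 e <;> cases c ω.2.1 (ι i) <;> cases c ω.2.1 (ι j) <;> simp [colourDist, eq_comm]
      have hRC : ∑ r : R, (colourDist (c r.1 (ι i)) (c r.1 (ι j))) =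
          m / (2 * m - 1) * Fintype.card R := by
        rw [Fintype.sum_prod_type_right, Fintype.card_prod]
        simp only [hc _ _ (ι.injective.ne hij)]
        rw [Finset.sum_const, nsmul_eq_mul, Finset.card_univ]
        push_cast
        ring
      simp only [hpt]
      rw [Fintype.sum_prod_type, Finset.mul_sum]
      refine Finset.sum_congr rfl fun ω _ => ?_
      change ∑ r : R, d ω (src e) (tgt e) * colourDist (c r.1 (ι i)) (c r.1 (ι j)) = _
      rw [← Finset.mul_sum, hRC]
      ring
    change (∑ ω, f ω) / _ = _
    simp only [this, hcard, hDd]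
    field_simp

/-! ### Two branches of a block -/

/-- The probability that two independent events, of probabilities `a` and `b`, do not agree. -/
def disagree (a b : ℝ) : ℝ := a * (1 - b) + b * (1 - a)

/-- The probability that a point at relative height `α` on a branch of a block gets the colour of
the bottom of the block, given that the top does not and the middle of the branch does. -/
noncomputable def bottomHigh (α : ℝ) : ℝ := min 1 (2 - 2 * α)

/-- The probability that a point at relative height `α` on a branch of a block gets the colour of
the bottom of the block, given that neither the top nor the middle of the branch does. -/
noncomputable def bottomLow (α : ℝ) : ℝ := max 0 (1 - 2 * α)

/-- The probability that two points at relative heights `α` and `β` on different branches of a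
block are separated, if the bottom and the top of the block are. Here `θ` is the probability that
the middles of the two branches are separated. -/
noncomputable def branchSep (θ α β : ℝ) : ℝ :=
  (1 - θ) / 2 *
      (disagree (bottomHigh α) (bottomHigh β) + disagree (bottomLow α) (bottomLow β)) +
    θ / 2 * (disagree (bottomHigh α) (bottomLow β) + disagree (bottomLow α) (bottomHigh β))

theorem bottomHigh_of_le {α : ℝ} (h : α ≤ 1 / 2) : bottomHigh α = 1 :=
  min_eq_left (by linarith)

theorem bottomHigh_of_ge {α : ℝ} (h : 1 / 2 ≤ α) : bottomHigh α = 2 - 2 * α :=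
  min_eq_right (by linarith)

theorem bottomLow_of_le {α : ℝ} (h : α ≤ 1 / 2) : bottomLow α = 1 - 2 * α :=
  max_eq_right (by linarith)

theorem bottomLow_of_ge {α : ℝ} (h : 1 / 2 ≤ α) : bottomLow α = 0 :=
  max_eq_left (by linarith)

/-- The interval of relative heights from `α` to `α + δ` lies in one half of a block. -/
def InHalf (α δ : ℝ) : Prop := 0 ≤ α ∧ 0 ≤ δ ∧ α + δ ≤ 1 ∧ (α + δ ≤ 1 / 2 ∨ 1 / 2 ≤ α)

theorem InHalf.lower {α δ : ℝ} (h : InHalf α δ) : InHalf α (δ / 2) := by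
  obtain ⟨h0, h1, h2, h3⟩ := h
  exact ⟨h0, by linarith, by linarith, h3.imp (fun h => by linarith) id⟩

theorem InHalf.upper {α δ : ℝ} (h : InHalf α δ) : InHalf (α + δ / 2) (δ / 2) := by
  obtain ⟨h0, h1, h2, h3⟩ := h
  exact ⟨by linarith, by linarith, by linarith,
    h3.imp (fun h => by linarith) fun h => by linarith⟩

theorem InHalf.bottomHigh_mid {α δ : ℝ} (h : InHalf α δ) :
    bottomHigh (α + δ / 2) = (bottomHigh α + bottomHigh (α + δ)) / 2 := by
  obtain ⟨-, h1, -, h3 | h3⟩ := h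
  · rw [bottomHigh_of_le (by linarith), bottomHigh_of_le (by linarith), bottomHigh_of_le h3]
    norm_num
  · rw [bottomHigh_of_ge (by linarith), bottomHigh_of_ge h3, bottomHigh_of_ge (by linarith)]
    ring

theorem InHalf.bottomLow_mid {α δ : ℝ} (h : InHalf α δ) :
    bottomLow (α + δ / 2) = (bottomLow α + bottomLow (α + δ)) / 2 := by
  obtain ⟨-, h1, -, h3 | h3⟩ := h
  · rw [bottomLow_of_le (by linarith), bottomLow_of_le (by linarith), bottomLow_of_le h3]
    ring
  · rw [bottomLow_of_ge (by linarith), bottomLow_of_ge h3, bottomLow_of_ge (by linarith)]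
    norm_num

theorem InHalf.branchSep_mid_left {α δ : ℝ} (h : InHalf α δ) (θ β : ℝ) :
    branchSep θ (α + δ / 2) β = (branchSep θ α β + branchSep θ (α + δ) β) / 2 := by
  simp only [branchSep, disagree, h.bottomHigh_mid, h.bottomLow_mid]
  ring

theorem branchSep_comm (θ α β : ℝ) : branchSep θ α β = branchSep θ β α := by
  simp only [branchSep, disagree]
  ring

theorem InHalf.branchSep_mid_right {β δ : ℝ} (h : InHalf β δ) (θ α : ℝ) :
    branchSep θ α (β + δ / 2) = (branchSep θ α β + branchSep θ α (β + δ)) / 2 := by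
  simp only [branchSep_comm θ α, h.branchSep_mid_left]

theorem branchSep_zero_left (θ β : ℝ) : branchSep θ 0 β = β := by
  simp only [branchSep, disagree, bottomHigh_of_le (show (0 : ℝ) ≤ 1 / 2 by norm_num),
    bottomLow_of_le (show (0 : ℝ) ≤ 1 / 2 by norm_num)]
  rcases le_total β (1 / 2) with h | h
  · rw [bottomHigh_of_le h, bottomLow_of_le h]; ring
  · rw [bottomHigh_of_ge h, bottomLow_of_ge h]; ring

theorem branchSep_one_left (θ β : ℝ) : branchSep θ 1 β = 1 - β := by
  simp only [branchSep, disagree, bottomHigh_of_ge (show (1 / 2 : ℝ) ≤ 1 by norm_num),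
    bottomLow_of_ge (show (1 / 2 : ℝ) ≤ 1 by norm_num)]
  rcases le_total β (1 / 2) with h | h
  · rw [bottomHigh_of_le h, bottomLow_of_le h]; ring
  · rw [bottomHigh_of_ge h, bottomLow_of_ge h]; ring

theorem branchSep_half_half (θ : ℝ) : branchSep θ (1 / 2) (1 / 2) = θ := by
  simp only [branchSep, disagree, bottomHigh_of_le le_rfl, bottomLow_of_le le_rfl]
  ring

theorem branchSep_one_sub (θ α β : ℝ) : branchSep θ (1 - α) (1 - β) = branchSep θ α β := by
  have h1 : ∀ x, bottomHigh (1 - x) = 1 - bottomLow x := fun x => by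
    rcases le_total x (1 / 2) with h | h
    · rw [bottomHigh_of_ge (by linarith), bottomLow_of_le h]; ring
    · rw [bottomHigh_of_le (by linarith), bottomLow_of_ge h]; ring
  have h2 : ∀ x, bottomLow (1 - x) = 1 - bottomHigh x := fun x => by
    rcases le_total x (1 / 2) with h | h
    · rw [bottomLow_of_ge (by linarith), bottomHigh_of_le h]; ring
    · rw [bottomLow_of_le (by linarith), bottomHigh_of_ge h]; ring
  simp only [branchSep, disagree, h1, h2]
  ring

/-- Two points in the lower halves of their branches: here even the factor `θ` is possible. -/
theorem le_branchSep_of_lower {θ α β : ℝ} (hθ : 1 / 2 ≤ θ) (hθ1 : θ ≤ 1) (hα : 0 ≤ α)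
    (hα' : α ≤ 1 / 2) (hβ : 0 ≤ β) (hβ' : β ≤ 1 / 2) :
    (1 - 1 / (4 * θ)) * (α + β) ≤ branchSep θ α β := by
  have hF : branchSep θ α β = (α + β) - (4 - 4 * θ) * (α * β) := by
    simp only [branchSep, disagree, bottomHigh_of_le hα', bottomHigh_of_le hβ',
      bottomLow_of_le hα', bottomLow_of_le hβ']
    ring
  have h1 : α * β ≤ (α + β) / 4 := by
    nlinarith [mul_nonneg hα (sub_nonneg.2 hβ'), mul_nonneg hβ (sub_nonneg.2 hα')]
  have h2 : θ * (α + β) ≤ branchSep θ α β := by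
    rw [hF]
    nlinarith [mul_le_mul_of_nonneg_left h1 (sub_nonneg.2 hθ1)]
  have h3 : 1 - 1 / (4 * θ) ≤ θ := by
    have h4 : 0 < 4 * θ := by linarith
    have : 1 - θ ≤ 1 / (4 * θ) := by
      rw [le_div_iff₀ h4]
      nlinarith [sq_nonneg (2 * θ - 1)]
    linarith
  exact (mul_le_mul_of_nonneg_right h3 (by linarith)).trans h2

/-- A point in the lower half of its branch and a point in the upper half of another one: this is
the critical case. In terms of `σ = α + (1 - β)` and `τ = α - (1 - β)` the separation probability
is `1 - σ + θ (σ² - τ²)`, which for `τ = 0` has the minimum `1 - 1 / (4 θ)`, at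
`σ = 1 / (2 θ)`. -/
theorem le_branchSep_of_opposite {θ α β : ℝ} (hθ : 1 / 2 ≤ θ) (hθ1 : θ ≤ 1) (hα : 0 ≤ α)
    (hα' : α ≤ 1 / 2) (hβ : 1 / 2 ≤ β) (hβ' : β ≤ 1) :
    (1 - 1 / (4 * θ)) * min (α + β) (2 - α - β) ≤ branchSep θ α β := by
  have hF : branchSep θ α β =
      1 - (α + (1 - β)) + θ * ((α + (1 - β)) ^ 2 - (α - (1 - β)) ^ 2) := by
    simp only [branchSep, disagree, bottomHigh_of_le hα', bottomHigh_of_ge hβ,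
      bottomLow_of_le hα', bottomLow_of_ge hβ]
    ring
  have hθ0 : 0 < θ := by linarith
  have hmin : ∀ σ : ℝ, 1 - 1 / (4 * θ) ≤ 1 - σ + θ * σ ^ 2 := by
    intro σ
    have : 1 - σ + θ * σ ^ 2 - (1 - 1 / (4 * θ)) = θ * (σ - 1 / (2 * θ)) ^ 2 := by
      field_simp
      ring
    nlinarith [mul_nonneg hθ0.le (sq_nonneg (σ - 1 / (2 * θ)))]
  have hτ : ∀ τ : ℝ, 0 ≤ τ → τ ≤ 1 / 2 → θ * τ ^ 2 ≤ (1 - 1 / (4 * θ)) * τ := by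
    intro τ h0 h1
    have h2 : θ / 2 ≤ 1 - 1 / (4 * θ) := by
      have : 1 / (4 * θ) ≤ 1 - θ / 2 := by
        rw [div_le_iff₀ (by linarith)]
        nlinarith [mul_nonneg (sub_nonneg.2 hθ) (sub_nonneg.2 hθ1)]
      linarith
    calc θ * τ ^ 2 = θ * τ * τ := by ring
      _ ≤ (1 - 1 / (4 * θ)) * τ := by
        refine mul_le_mul_of_nonneg_right (le_trans ?_ h2) h0
        nlinarith
  rw [hF]
  have hm := hmin (α + (1 - β))
  rcases le_total (α + β) 1 with h | h
  · rw [min_eq_left (by linarith)]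
    have := hτ (1 - β - α) (by linarith) (by linarith)
    nlinarith
  · rw [min_eq_right (by linarith)]
    have := hτ (α - (1 - β)) (by linarith) (by linarith)
    nlinarith

/-- In a block of height `1`, two points at heights `α` and `β` on different branches have the
distance `min (α + β) (2 - α - β)`. Their separation probability is at least `1 - 1 / (4 θ)` times
this distance. -/
theorem le_branchSep {θ α β : ℝ} (hθ : 1 / 2 ≤ θ) (hθ1 : θ ≤ 1) (hα : 0 ≤ α)
    (hα' : α ≤ 1) (hβ : 0 ≤ β) (hβ' : β ≤ 1) :
    (1 - 1 / (4 * θ)) * min (α + β) (2 - α - β) ≤ branchSep θ α β := by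
  have hc : 0 ≤ 1 - 1 / (4 * θ) := by
    have : 1 / (4 * θ) ≤ 1 := by
      rw [div_le_one (by linarith)]
      linarith
    linarith
  rcases le_total α (1 / 2) with h | h <;> rcases le_total β (1 / 2) with h' | h'
  · exact (mul_le_mul_of_nonneg_left (min_le_left _ _) hc).trans
      (le_branchSep_of_lower hθ hθ1 hα h hβ h')
  · exact le_branchSep_of_opposite hθ hθ1 hα h h' hβ'
  · have := le_branchSep_of_opposite hθ hθ1 hβ h' h hα'
    rwa [branchSep_comm, add_comm, sub_right_comm] at this
  · rw [← branchSep_one_sub]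
    refine (mul_le_mul_of_nonneg_left (min_le_right _ _) hc).trans ?_
    have := le_branchSep_of_lower (α := 1 - α) (β := 1 - β) hθ hθ1 (by linarith) (by linarith)
      (by linarith) (by linarith)
    rwa [show 1 - α + (1 - β) = 2 - α - β by ring] at this

/-! ### Walks of bounded length -/

namespace STGraph

/-- There is a walk from `x` to `y` of length at most `r`. -/
def Within (G : STGraph) (x y : G.V) (r : ℝ) : Prop :=
  ∃ l : ℝ≥0, G.HasWalk x y l ∧ (l : ℝ) ≤ r

namespace Within

variable {G : STGraph} {x y z : G.V} {r r' : ℝ}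

theorem refl (x : G.V) (h : 0 ≤ r) : G.Within x x r := ⟨0, .nil x, h⟩

theorem symm (h : G.Within x y r) : G.Within y x r := by
  obtain ⟨l, hl, hr⟩ := h
  exact ⟨l, hl.reverse, hr⟩

theorem mono (h : G.Within x y r) (hr : r ≤ r') : G.Within x y r' := by
  obtain ⟨l, hl, hl'⟩ := h
  exact ⟨l, hl, hl'.trans hr⟩

theorem trans (h : G.Within x y r) (h' : G.Within y z r') : G.Within x z (r + r') := by
  obtain ⟨l, hl, hr⟩ := h
  obtain ⟨l', hl', hr'⟩ := h'
  exact ⟨l + l', hl.append hl', by push_cast; linarith⟩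

theorem edge (e : G.E) : G.Within (G.src e) (G.tgt e) (G.len e) :=
  ⟨G.len e + 0, .forward e (.nil _), by simp⟩

theorem edist_le (h : G.Within x y r) : edist x y ≤ ENNReal.ofReal r := by
  obtain ⟨l, hl, hr⟩ := h
  refine (pathDist_le hl).trans ?_
  rw [← ENNReal.ofReal_coe_nnreal]
  exact ENNReal.ofReal_le_ofReal hr

end Within

/-- A semimetric that is at most the length on each edge is at most the shortest-path distance. -/
theorem HasWalk.semimetric_le {G : STGraph} {D : G.V → G.V → ℝ} (self : ∀ x, D x x = 0)
    (symm : ∀ x y, D x y = D y x) (triangle : ∀ x y z, D x z ≤ D x y + D y z)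
    (edge : ∀ e, D (G.src e) (G.tgt e) ≤ G.len e) {x y : G.V} {l : ℝ≥0} (h : G.HasWalk x y l) :
    D x y ≤ l := by
  induction h with
  | nil u => simp [self]
  | @forward e v l _ ih =>
    push_cast
    linarith [triangle (G.src e) (G.tgt e) v, edge e]
  | @backward e v l _ ih =>
    push_cast
    linarith [triangle (G.tgt e) (G.src e) v, edge e, symm (G.src e) (G.tgt e)]

theorem HasWalk.le_of_ne {G : STGraph} {ℓ : ℝ≥0} (hlen : ∀ e, G.len e = ℓ) {x y : G.V}
    {l : ℝ≥0} (h : G.HasWalk x y l) (hxy : x ≠ y) : ℓ ≤ l := by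
  cases h with
  | nil => exact absurd rfl hxy
  | forward e _ => rw [hlen]; exact le_self_add
  | backward e _ => rw [hlen]; exact le_self_add

/-! ### Replacing an edge by `K_{2,n}` -/

theorem edist_K2 {n : ℕ} (hn : 1 ≤ n) : edist (K2 n).s (K2 n).t = 2 := by
  refine le_antisymm ?_ (le_iInf₂ fun l hl => ?_)
  · have h1 : (K2 n).HasWalk (K2 n).s (K2 n).t (1 + (1 + 0)) :=
      HasWalk.forward (G := K2 n) (.inl ⟨0, hn⟩)
        (HasWalk.forward (G := K2 n) (.inr ⟨0, hn⟩) (HasWalk.nil (G := K2 n) (K2 n).t))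
    refine (pathDist_le h1).trans (le_of_eq ?_)
    rw [add_zero, one_add_one_eq_two]
    rfl
  · let φ : (K2 n).V → ℝ := Sum.elim (fun i : Fin 2 => 2 * (i : ℕ)) fun _ => 1
    have := hl.semimetric_le (D := fun x y => |φ x - φ y|) (by simp)
      (fun x y => abs_sub_comm _ _) (fun x y z => abs_sub_le _ _ _) (by
        rintro (i | i)
        · simp [φ, K2]
        · simp only [φ, K2, Sum.elim_inr, Sum.elim_inl]
          norm_num)
    have h2 : (2 : ℝ) ≤ l := by
      refine le_trans ?_ this
      simp [φ, K2]
    exact_mod_cast h2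

/-- A vertex of `H`, as a vertex of `H ⊘ K_{2,n}`. -/
def old {H : STGraph} {n : ℕ} (v : H.V) : (H.comp (K2 n)).V := Sum.inl v

/-- The `i`-th midpoint of the edge `e` of `H`, as a vertex of `H ⊘ K_{2,n}`. -/
def mid {H : STGraph} {n : ℕ} (e : H.E) (i : Fin n) : (H.comp (K2 n)).V :=
  Sum.inr (e, ⟨Sum.inr i, by simp [K2], by simp [K2]⟩)

/-- The edge from the bottom of `e` to the `i`-th midpoint of `e`. -/
def lower {H : STGraph} {n : ℕ} (e : H.E) (i : Fin n) : (H.comp (K2 n)).E := (e, Sum.inl i)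

/-- The edge from the `i`-th midpoint of `e` to the top of `e`. -/
def upper {H : STGraph} {n : ℕ} (e : H.E) (i : Fin n) : (H.comp (K2 n)).E := (e, Sum.inr i)

section comp

variable {H : STGraph} {n : ℕ}

theorem src_lower (e : H.E) (i : Fin n) :
    (H.comp (K2 n)).src (lower e i) = old (H.src e) := by
  simp [comp, copyVertex, K2, old, lower]

theorem tgt_lower (e : H.E) (i : Fin n) : (H.comp (K2 n)).tgt (lower e i) = mid e i := by
  simp [comp, copyVertex, K2, mid, lower]

theorem src_upper (e : H.E) (i : Fin n) : (H.comp (K2 n)).src (upper e i) = mid e i := by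
  simp [comp, copyVertex, K2, mid, upper]

theorem tgt_upper (e : H.E) (i : Fin n) :
    (H.comp (K2 n)).tgt (upper e i) = old (H.tgt e) := by
  simp [comp, copyVertex, K2, old, upper]

theorem exists_lower_or_upper (p : (H.comp (K2 n)).E) :
    ∃ e i, p = lower e i ∨ p = upper e i := by
  rcases p with ⟨e, i | i⟩
  exacts [⟨e, i, .inl rfl⟩, ⟨e, i, .inr rfl⟩]

theorem comp_len (hn : 1 ≤ n) (e : H.E) (j : (K2 n).E) :
    (H.comp (K2 n)).len (e, j) = H.len e / 2 := by
  change H.len e / (edist (K2 n).s (K2 n).t).toNNReal * 1 = _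
  rw [edist_K2 hn, mul_one]
  rfl

theorem len_lower (hn : 1 ≤ n) (e : H.E) (i : Fin n) :
    (H.comp (K2 n)).len (lower e i) = H.len e / 2 :=
  comp_len hn e _

theorem len_upper (hn : 1 ≤ n) (e : H.E) (i : Fin n) :
    (H.comp (K2 n)).len (upper e i) = H.len e / 2 :=
  comp_len hn e _

theorem exists_old_or_mid (x : (H.comp (K2 n)).V) :
    (∃ v, x = old v) ∨ ∃ e i, x = mid e i := by
  rcases x with v | ⟨e, ⟨i | i, h1, h2⟩⟩
  · exact .inl ⟨v, rfl⟩
  · exfalso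
    fin_cases i
    · exact h1 rfl
    · exact h2 rfl
  · exact .inr ⟨e, i, rfl⟩

theorem within_src_mid (hn : 1 ≤ n) (e : H.E) (i : Fin n) :
    (H.comp (K2 n)).Within (old (H.src e)) (mid e i) (H.len e / 2) := by
  have := Within.edge (G := H.comp (K2 n)) (lower e i)
  rw [src_lower, tgt_lower, len_lower hn] at this
  exact_mod_cast this

theorem within_mid_tgt (hn : 1 ≤ n) (e : H.E) (i : Fin n) :
    (H.comp (K2 n)).Within (mid e i) (old (H.tgt e)) (H.len e / 2) := by
  have := Within.edge (G := H.comp (K2 n)) (upper e i)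
  rw [src_upper, tgt_upper, len_upper hn] at this
  exact_mod_cast this

theorem Within.old (hn : 1 ≤ n) {x y : H.V} {r : ℝ} (h : H.Within x y r) :
    (H.comp (K2 n)).Within (old x) (old y) r := by
  have hedge : ∀ e : H.E, (H.comp (K2 n)).Within (STGraph.old (H.src e)) (STGraph.old (H.tgt e))
      (H.len e) := fun e =>
    ((within_src_mid hn e ⟨0, hn⟩).trans (within_mid_tgt hn e ⟨0, hn⟩)).mono (by linarith)
  obtain ⟨l, hl, hr⟩ := h
  refine Within.mono ?_ hr
  clear hr
  induction hl with
  | nil u => exact Within.refl _ le_rfl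
  | forward e _ ih => push_cast; exact (hedge e).trans ih
  | backward e _ ih => push_cast; exact (hedge e).symm.trans ih

end comp

/-! ### Pairs of points in series and in parallel -/

/-- `x` and `y` lie on a common geodesic, at distance (at most) `r`, and the semimetric `D` has the
value `r` there. -/
def SeriesAt (G : STGraph) (D : G.V → G.V → ℝ) (x y : G.V) (r : ℝ) : Prop :=
  G.Within x y r ∧ D x y = r

/-- `x` and `y` lie at relative heights `α` and `β` on different branches of a block of height `L`,
and the semimetric `D` has there the value that the random colouring of the block gives. The two
distance bounds are the lengths of the paths through the bottom and through the top of the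
block. -/
def ParallelAt (G : STGraph) (θ : ℝ) (D : G.V → G.V → ℝ) (L : ℝ) (x y : G.V) (α β : ℝ) : Prop :=
  G.Within x y (L * (α + β)) ∧ G.Within x y (L * (2 - α - β)) ∧ D x y = L * branchSep θ α β

section midpoints

variable {G : STGraph} {D : G.V → G.V → ℝ} {u m v y : G.V} {ℓ r θ L α β δ : ℝ}

theorem SeriesAt.mid_left (hu : G.SeriesAt D u y (r + ℓ)) (hv : G.SeriesAt D v y r)
    (hmv : G.Within m v (ℓ / 2)) (hD : D m y = (D u y + D v y) / 2) :
    G.SeriesAt D m y (r + ℓ / 2) :=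
  ⟨(hmv.trans hv.1).mono (by linarith), by rw [hD, hu.2, hv.2]; ring⟩

theorem SeriesAt.mid_right (hu : G.SeriesAt D y u r) (hv : G.SeriesAt D y v (r + ℓ))
    (hum : G.Within u m (ℓ / 2)) (hD : D y m = (D y u + D y v) / 2) :
    G.SeriesAt D y m (r + ℓ / 2) :=
  ⟨hu.1.trans hum, by rw [hD, hu.2, hv.2]; ring⟩

theorem ParallelAt.mid_left (hu : G.ParallelAt θ D L u y α β)
    (hv : G.ParallelAt θ D L v y (α + δ) β) (hα : InHalf α δ) (hL : L * δ = ℓ)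
    (hum : G.Within u m (ℓ / 2)) (hmv : G.Within m v (ℓ / 2))
    (hD : D m y = (D u y + D v y) / 2) : G.ParallelAt θ D L m y (α + δ / 2) β :=
  ⟨(hum.symm.trans hu.1).mono (by linarith), (hmv.trans hv.2.1).mono (by linarith), by
    rw [hD, hu.2.2, hv.2.2, hα.branchSep_mid_left]; ring⟩

theorem ParallelAt.mid_right (hu : G.ParallelAt θ D L y u α β)
    (hv : G.ParallelAt θ D L y v α (β + δ)) (hβ : InHalf β δ) (hL : L * δ = ℓ)
    (hum : G.Within u m (ℓ / 2)) (hmv : G.Within m v (ℓ / 2))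
    (hD : D y m = (D y u + D y v) / 2) : G.ParallelAt θ D L y m α (β + δ / 2) :=
  ⟨(hu.1.trans hum).mono (by linarith), (hv.2.1.trans hmv.symm).mono (by linarith), by
    rw [hD, hu.2.2, hv.2.2, hβ.branchSep_mid_right]; ring⟩

theorem SeriesAt.within (h : G.SeriesAt D u y r) (hD : 0 ≤ D u y) {c : ℝ} (hc : 0 < c)
    (hc1 : c ≤ 1) : G.Within u y (D u y / c) :=
  h.1.mono (by rw [← h.2]; exact le_div_self hD hc hc1)

theorem ParallelAt.within (h : G.ParallelAt θ D L u y α β) (hL : 0 ≤ L) (hθ : 1 / 2 ≤ θ)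
    (hθ1 : θ ≤ 1) (hα : 0 ≤ α) (hα' : α ≤ 1) (hβ : 0 ≤ β) (hβ' : β ≤ 1) :
    G.Within u y (D u y / (1 - 1 / (4 * θ))) := by
  have hc : 0 < 1 - 1 / (4 * θ) := by
    have : 1 / (4 * θ) < 1 := by
      rw [div_lt_one (by linarith)]
      linarith
    linarith
  have hmin : G.Within u y (L * min (α + β) (2 - α - β)) := by
    rcases min_choice (α + β) (2 - α - β) with h' | h' <;> rw [h']
    exacts [h.1, h.2.1]
  refine hmin.mono ?_
  rw [le_div_iff₀ hc, h.2.2]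
  calc _ = L * ((1 - 1 / (4 * θ)) * min (α + β) (2 - α - β)) := by ring
    _ ≤ _ := mul_le_mul_of_nonneg_left (le_branchSep hθ hθ1 hα hα' hβ hβ') hL

end midpoints
/-! ### The inductive invariant -/

/-- The edge `e` lies below the edge `e'` on a common geodesic. -/
def Series (G : STGraph) (D : G.V → G.V → ℝ) (ℓ : ℝ) (e e' : G.E) : Prop :=
  ∃ r, G.SeriesAt D (G.tgt e) (G.src e') r ∧ G.SeriesAt D (G.src e) (G.src e') (r + ℓ) ∧
    G.SeriesAt D (G.tgt e) (G.tgt e') (r + ℓ) ∧ G.SeriesAt D (G.src e) (G.tgt e') (r + ℓ + ℓ)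

/-- The edges `e` and `e'` lie on different branches of a block, where `e` occupies the relative
heights from `α` to `α + δ`, and `e'` those from `β` to `β + δ`. -/
def Parallel (G : STGraph) (θ : ℝ) (D : G.V → G.V → ℝ) (ℓ : ℝ) (e e' : G.E) : Prop :=
  ∃ L α β δ, 0 ≤ L ∧ L * δ = ℓ ∧ InHalf α δ ∧ InHalf β δ ∧
    G.ParallelAt θ D L (G.src e) (G.src e') α β ∧
    G.ParallelAt θ D L (G.src e) (G.tgt e') α (β + δ) ∧
    G.ParallelAt θ D L (G.tgt e) (G.src e') (α + δ) β ∧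
    G.ParallelAt θ D L (G.tgt e) (G.tgt e') (α + δ) (β + δ)

/-- The invariant of the construction: all edges of `G` have the length `ℓ`, and `D` is a cut
metric that is isometric on the edges and has the expected values on each pair of edges. -/
structure IsMonotoneCut (G : STGraph) (θ : ℝ) (ℓ : ℝ≥0) (D : G.V → G.V → ℝ) : Prop where
  finite : Finite G.E
  pos : 0 < ℓ
  len : ∀ e, G.len e = ℓ
  incident : ∀ v, ∃ e, v = G.src e ∨ v = G.tgt e
  cut : IsCutMetric D
  edge : ∀ e, D (G.src e) (G.tgt e) = ℓ
  pair : ∀ e e', e ≠ e' → G.Series D ℓ e e' ∨ G.Series D ℓ e' e ∨ G.Parallel θ D ℓ e e'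

theorem isMonotoneCut_singleEdge (θ : ℝ) :
    ∃ D, IsMonotoneCut singleEdge θ 1 D := by
  let c : singleEdge.V → Bool := fun x : Fin 2 => decide (x = 0)
  refine ⟨fun x y => (∑ _ω : Unit, colourDist (c x) (c y)) / Fintype.card Unit, ?_⟩
  refine ⟨inferInstanceAs (Finite Unit), one_pos, fun e => rfl, fun v => ⟨(), ?_⟩,
    ⟨Unit, inferInstance, inferInstance, fun _ => c, fun x y => rfl⟩,
    fun e => ?_, fun e e' h => absurd (Subsingleton.elim (α := Unit) e e') h⟩
  · change v = (0 : Fin 2) ∨ v = (1 : Fin 2)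
    revert v
    change ∀ v : Fin 2, v = 0 ∨ v = 1
    decide
  · simp [c, singleEdge, colourDist]

section step

variable {H : STGraph} {n : ℕ} {θ : ℝ} {ℓ : ℝ≥0} {D : H.V → H.V → ℝ}
  {D' : (H.comp (K2 n)).V → (H.comp (K2 n)).V → ℝ}

/-- Two descendants of edges in series are in series. -/
theorem Series.comp (hn : 1 ≤ n) {e e' : H.E} (h : H.Series D ℓ e e') (he : H.len e = ℓ)
    (he' : H.len e' = ℓ) (hold : ∀ u v, D' (old u) (old v) = D u v)
    (hleft : ∀ i y, (∃ v, y = old v) ∨ (∃ j, y = mid e' j) →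
      D' (mid e i) y = (D' (old (H.src e)) y + D' (old (H.tgt e)) y) / 2)
    (hright : ∀ j y, (∃ v, y = old v) →
      D' y (mid e' j) = (D' y (old (H.src e')) + D' y (old (H.tgt e'))) / 2)
    {p p' : (H.comp (K2 n)).E} {i j : Fin n} (hp : p = lower e i ∨ p = upper e i)
    (hp' : p' = lower e' j ∨ p' = upper e' j) :
    (H.comp (K2 n)).Series D' (ℓ / 2 : ℝ≥0) p p' := by
  obtain ⟨r, hvu, huu, hvv, huv⟩ := h
  have lift : ∀ {x y : H.V} {r : ℝ}, H.SeriesAt D x y r →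
      (H.comp (K2 n)).SeriesAt D' (old x) (old y) r := fun h => ⟨h.1.old hn, by rw [hold, h.2]⟩
  have hum := within_src_mid hn e i
  have hmv := within_mid_tgt hn e i
  have hum' := within_src_mid hn e' j
  have hmv' := within_mid_tgt hn e' j
  rw [he] at hum hmv
  rw [he'] at hum' hmv'
  have mu := (lift huu).mid_left (lift hvu) hmv (hleft i _ (.inl ⟨_, rfl⟩))
  have mv := (lift huv).mid_left (lift hvv) hmv (hleft i _ (.inl ⟨_, rfl⟩))
  have um := (lift huu).mid_right (lift huv) hum' (hright j _ ⟨_, rfl⟩)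
  have vm := (lift hvu).mid_right (lift hvv) hum' (hright j _ ⟨_, rfl⟩)
  have mm := SeriesAt.mid_left (ℓ := ℓ) (r := r + ℓ / 2)
    (by convert um using 1; ring) vm hmv (hleft i _ (.inr ⟨j, rfl⟩))
  rcases hp with rfl | rfl <;> rcases hp' with rfl | rfl
  · refine ⟨r + ℓ / 2, ?_, ?_, ?_, ?_⟩ <;> simp only [src_lower, tgt_lower] <;> push_cast
    · exact mu
    · convert lift huu using 1; ring
    · exact mm
    · convert um using 1; ring
  · refine ⟨r + ℓ / 2 + ℓ / 2, ?_, ?_, ?_, ?_⟩ <;>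
      simp only [src_lower, tgt_lower, src_upper, tgt_upper] <;> push_cast
    · exact mm
    · convert um using 1; ring
    · convert mv using 1; ring
    · convert lift huv using 1; ring
  · refine ⟨r, ?_, ?_, ?_, ?_⟩ <;>
      simp only [src_lower, tgt_lower, src_upper, tgt_upper] <;> push_cast
    · exact lift hvu
    · exact mu
    · exact vm
    · exact mm
  · refine ⟨r + ℓ / 2, ?_, ?_, ?_, ?_⟩ <;> simp only [src_upper, tgt_upper] <;> push_cast
    · exact vm
    · exact mm
    · convert lift hvv using 1; ring
    · convert mv using 1; ring

/-- Two descendants of edges in parallel are in parallel. -/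
theorem Parallel.comp (hn : 1 ≤ n) {e e' : H.E} (h : H.Parallel θ D ℓ e e') (he : H.len e = ℓ)
    (he' : H.len e' = ℓ) (hold : ∀ u v, D' (old u) (old v) = D u v)
    (hleft : ∀ i y, (∃ v, y = old v) ∨ (∃ j, y = mid e' j) →
      D' (mid e i) y = (D' (old (H.src e)) y + D' (old (H.tgt e)) y) / 2)
    (hright : ∀ j y, (∃ v, y = old v) →
      D' y (mid e' j) = (D' y (old (H.src e')) + D' y (old (H.tgt e'))) / 2)
    {p p' : (H.comp (K2 n)).E} {i j : Fin n} (hp : p = lower e i ∨ p = upper e i)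
    (hp' : p' = lower e' j ∨ p' = upper e' j) :
    (H.comp (K2 n)).Parallel θ D' (ℓ / 2 : ℝ≥0) p p' := by
  obtain ⟨L, α, β, δ, hL, hLδ, hα, hβ, huu, huv, hvu, hvv⟩ := h
  have lift : ∀ {x y : H.V} {α β : ℝ}, H.ParallelAt θ D L x y α β →
      (H.comp (K2 n)).ParallelAt θ D' L (old x) (old y) α β :=
    fun h => ⟨h.1.old hn, h.2.1.old hn, by rw [hold, h.2.2]⟩
  have hum := within_src_mid hn e i
  have hmv := within_mid_tgt hn e i
  have hum' := within_src_mid hn e' j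
  have hmv' := within_mid_tgt hn e' j
  rw [he] at hum hmv
  rw [he'] at hum' hmv'
  have mu := (lift huu).mid_left (lift hvu) hα hLδ hum hmv (hleft i _ (.inl ⟨_, rfl⟩))
  have mv := (lift huv).mid_left (lift hvv) hα hLδ hum hmv (hleft i _ (.inl ⟨_, rfl⟩))
  have um := (lift huu).mid_right (lift huv) hβ hLδ hum' hmv' (hright j _ ⟨_, rfl⟩)
  have vm := (lift hvu).mid_right (lift hvv) hβ hLδ hum' hmv' (hright j _ ⟨_, rfl⟩)
  have mm := um.mid_left vm hα hLδ hum hmv (hleft i _ (.inr ⟨j, rfl⟩))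
  have hLδ' : L * (δ / 2) = (ℓ / 2 : ℝ≥0) := by push_cast; linarith
  have hδ : ∀ x : ℝ, x + δ / 2 + δ / 2 = x + δ := fun x => by ring
  rcases hp with rfl | rfl <;> rcases hp' with rfl | rfl
  · refine ⟨L, α, β, δ / 2, hL, hLδ', hα.lower, hβ.lower, ?_⟩
    simp only [src_lower, tgt_lower]
    exact ⟨lift huu, um, mu, mm⟩
  · refine ⟨L, α, β + δ / 2, δ / 2, hL, hLδ', hα.lower, hβ.upper, ?_⟩
    simp only [src_lower, tgt_lower, src_upper, tgt_upper, hδ]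
    exact ⟨um, lift huv, mm, mv⟩
  · refine ⟨L, α + δ / 2, β, δ / 2, hL, hLδ', hα.upper, hβ.lower, ?_⟩
    simp only [src_lower, tgt_lower, src_upper, tgt_upper, hδ]
    exact ⟨mu, mm, lift hvu, vm⟩
  · refine ⟨L, α + δ / 2, β + δ / 2, δ / 2, hL, hLδ', hα.upper, hβ.upper, ?_⟩
    simp only [src_upper, tgt_upper, hδ]
    exact ⟨mm, mv, vm, lift hvv⟩

/-- Two descendants of the same edge, on different branches. -/
theorem parallel_of_same_edge (hn : 1 ≤ n) {e : H.E} (he : H.len e = ℓ) (hD : IsCutMetric D)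
    (hDe : D (H.src e) (H.tgt e) = ℓ) (hD' : IsCutMetric D')
    (hold : ∀ u v, D' (old u) (old v) = D u v)
    (hmid : ∀ i v, D' (old v) (mid e i) = (D v (H.src e) + D v (H.tgt e)) / 2)
    (hmm : ∀ i j, i ≠ j → D' (mid e i) (mid e j) = θ * D (H.src e) (H.tgt e))
    {p p' : (H.comp (K2 n)).E} {i j : Fin n} (hij : i ≠ j)
    (hp : p = lower e i ∨ p = upper e i) (hp' : p' = lower e j ∨ p' = upper e j) :
    (H.comp (K2 n)).Parallel θ D' (ℓ / 2 : ℝ≥0) p p' := by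
  have hDe' : D (H.tgt e) (H.src e) = ℓ := by rw [hD.symm, hDe]
  have hum := fun i => within_src_mid (n := n) hn e i
  have hmv := fun i => within_mid_tgt (n := n) hn e i
  rw [he] at hum hmv
  have hℓ : (0 : ℝ) ≤ ℓ := ℓ.2
  have huv := (hum i).trans (hmv i)
  -- the values of `D'` at midpoints, the other argument being an endpoint of `e`
  have hsm : ∀ i, D' (old (H.src e)) (mid e i) = ℓ / 2 := fun i => by
    rw [hmid, hD.self, hDe, zero_add]
  have htm : ∀ i, D' (old (H.tgt e)) (mid e i) = ℓ / 2 := fun i => by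
    rw [hmid, hD.self, hDe', add_zero]
  have uu : (H.comp (K2 n)).ParallelAt θ D' ℓ (old (H.src e)) (old (H.src e)) 0 0 :=
    ⟨Within.refl _ (by simp), Within.refl _ (by linarith), by
      rw [hD'.self, branchSep_zero_left, mul_zero]⟩
  have um : ∀ i, (H.comp (K2 n)).ParallelAt θ D' ℓ (old (H.src e)) (mid e i) 0 (1 / 2) :=
    fun i => ⟨(hum i).mono (by linarith), (hum i).mono (by linarith), by
      rw [hsm, branchSep_zero_left]; ring⟩
  have mm : (H.comp (K2 n)).ParallelAt θ D' ℓ (mid e i) (mid e j) (1 / 2) (1 / 2) :=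
    ⟨((hum i).symm.trans (hum j)).mono (by linarith),
      ((hum i).symm.trans (hum j)).mono (by linarith), by
      rw [hmm i j hij, hDe, branchSep_half_half]; ring⟩
  have uv : (H.comp (K2 n)).ParallelAt θ D' ℓ (old (H.src e)) (old (H.tgt e)) 0 1 :=
    ⟨huv.mono (by linarith), huv.mono (by linarith), by
      rw [hold, hDe, branchSep_zero_left, mul_one]⟩
  have vm : ∀ i, (H.comp (K2 n)).ParallelAt θ D' ℓ (old (H.tgt e)) (mid e i) 1 (1 / 2) :=
    fun i => ⟨(hmv i).symm.mono (by linarith), (hmv i).symm.mono (by linarith), by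
      rw [htm, branchSep_one_left]; ring⟩
  have vv : (H.comp (K2 n)).ParallelAt θ D' ℓ (old (H.tgt e)) (old (H.tgt e)) 1 1 :=
    ⟨Within.refl _ (by linarith), Within.refl _ (by linarith), by
      rw [hD'.self, branchSep_one_left]; ring⟩
  have swap : ∀ {x y α β}, (H.comp (K2 n)).ParallelAt θ D' ℓ x y α β →
      (H.comp (K2 n)).ParallelAt θ D' ℓ y x β α := fun h =>
    ⟨h.1.symm.mono (by linarith), h.2.1.symm.mono (by linarith), by
      rw [hD'.symm, h.2.2, branchSep_comm]⟩
  have hlow : InHalf 0 (1 / 2) := ⟨le_rfl, by norm_num, by norm_num, .inl (by norm_num)⟩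
  have hupp : InHalf (1 / 2) (1 / 2) :=
    ⟨by norm_num, by norm_num, by norm_num, .inr le_rfl⟩
  have hLδ : (ℓ : ℝ) * (1 / 2) = (ℓ / 2 : ℝ≥0) := by push_cast; ring
  rcases hp with rfl | rfl <;> rcases hp' with rfl | rfl
  · refine ⟨ℓ, 0, 0, 1 / 2, hℓ, hLδ, hlow, hlow, ?_⟩
    simp only [src_lower, tgt_lower, zero_add]
    exact ⟨uu, um j, swap (um i), mm⟩
  · refine ⟨ℓ, 0, 1 / 2, 1 / 2, hℓ, hLδ, hlow, hupp, ?_⟩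
    simp only [src_lower, tgt_lower, src_upper, tgt_upper, zero_add, add_halves]
    exact ⟨um j, uv, mm, swap (vm i)⟩
  · refine ⟨ℓ, 1 / 2, 0, 1 / 2, hℓ, hLδ, hupp, hlow, ?_⟩
    simp only [src_lower, tgt_lower, src_upper, tgt_upper, zero_add, add_halves]
    exact ⟨swap (um i), mm, swap uv, vm j⟩
  · refine ⟨ℓ, 1 / 2, 1 / 2, 1 / 2, hℓ, hLδ, hupp, hupp, ?_⟩
    simp only [src_upper, tgt_upper, add_halves]
    exact ⟨mm, swap (vm i), vm j, vv⟩

/-- The two halves of one path between the endpoints of an edge. -/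
theorem series_lower_upper (hn : 1 ≤ n) {e : H.E} (he : H.len e = ℓ) (hD : IsCutMetric D)
    (hDe : D (H.src e) (H.tgt e) = ℓ) (hD' : IsCutMetric D')
    (hold : ∀ u v, D' (old u) (old v) = D u v)
    (hmid : ∀ i v, D' (old v) (mid e i) = (D v (H.src e) + D v (H.tgt e)) / 2) (i : Fin n) :
    (H.comp (K2 n)).Series D' (ℓ / 2 : ℝ≥0) (lower e i) (upper e i) := by
  have hum := within_src_mid hn e i
  have hmv := within_mid_tgt hn e i
  rw [he] at hum hmv
  refine ⟨0, ?_, ?_, ?_, ?_⟩ <;> simp only [src_lower, tgt_lower, src_upper, tgt_upper] <;>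
    push_cast
  · exact ⟨Within.refl _ le_rfl, hD'.self _⟩
  · exact ⟨hum.mono (by linarith), by rw [hmid, hD.self, hDe]; ring⟩
  · refine ⟨hmv.mono (by linarith), ?_⟩
    rw [hD'.symm, hmid, hD.self, hD.symm, hDe, zero_add, add_zero]
  · exact ⟨(hum.trans hmv).mono (by linarith), by rw [hold, hDe]; ring⟩

/-- The invariant passes from `H` to `H ⊘ K_{2,n}`. -/
theorem IsMonotoneCut.comp {m : ℕ} (hn : 1 ≤ n) (hm : 1 ≤ m) (hnm : n ≤ 2 * m)
    (h : IsMonotoneCut H (m / (2 * m - 1)) ℓ D) :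
    ∃ D', IsMonotoneCut (H.comp (K2 n)) (m / (2 * m - 1)) (ℓ / 2) D' := by
  have := h.finite
  obtain ⟨κ⟩ : Nonempty (Fin n ↪ Fin m ⊕ Fin m) :=
    Function.Embedding.nonempty_of_card_le (by simpa [two_mul] using hnm)
  let index : {v : (K2 n).V // v ≠ (K2 n).s ∧ v ≠ (K2 n).t} → Fin n :=
    fun v => Sum.elim (fun _ : Fin 2 => ⟨0, hn⟩) id v.1
  have hindex : Function.Injective index := by
    have key : ∀ v : {v : (K2 n).V // v ≠ (K2 n).s ∧ v ≠ (K2 n).t}, v.1 = Sum.inr (index v) := by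
      rintro ⟨i | i, h1, h2⟩
      · exfalso
        fin_cases i
        · exact h1 rfl
        · exact h2 rfl
      · rfl
    intro v w hvw
    exact Subtype.ext (by rw [key v, key w, hvw])
  obtain ⟨D', hcut, hold', hom, hmm, hsame'⟩ :=
    h.cut.subdivide H.src H.tgt hm ((⟨index, hindex⟩ : Function.Embedding _ _).trans κ)
  let D₁ : (H.comp (K2 n)).V → (H.comp (K2 n)).V → ℝ := D'
  have hcut : IsCutMetric D₁ := hcut
  have hold : ∀ u v, D₁ (old u) (old v) = D u v := hold'
  have hmid : ∀ e i v, D₁ (old v) (mid e i) = (D v (H.src e) + D v (H.tgt e)) / 2 :=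
    fun e i v => hom v e _
  have hmm : ∀ e e' i j, e ≠ e' → D₁ (mid e i) (mid e' j) = _ := fun e e' i j hee =>
    hmm e e' _ _ hee
  have hsame : ∀ e i j, i ≠ j →
      D₁ (mid e i) (mid e j) = m / (2 * m - 1) * D (H.src e) (H.tgt e) := fun e i j hij =>
    hsame' e _ _ fun h => hij (Sum.inr_injective (congrArg Subtype.val h))
  have hleft : ∀ e e', e ≠ e' → ∀ (i : Fin n) y, (∃ v, y = old v) ∨ (∃ j, y = mid e' j) →
      D₁ (mid e i) y = (D₁ (old (H.src e)) y + D₁ (old (H.tgt e)) y) / 2 := by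
    rintro e e' hee i y (⟨v, rfl⟩ | ⟨j, rfl⟩)
    · rw [hcut.symm, hmid, hold, hold, h.cut.symm v, h.cut.symm v]
    · rw [hmm e e' i j hee, hmid, hmid]
      ring
  have hright : ∀ e' (j : Fin n) y, (∃ v, y = old v) →
      D₁ y (mid e' j) = (D₁ y (old (H.src e')) + D₁ y (old (H.tgt e'))) / 2 := by
    rintro e' j y ⟨v, rfl⟩
    rw [hmid, hold, hold]
  refine ⟨D₁, ⟨?_, half_pos h.pos, ?_, ?_, hcut, ?_, ?_⟩⟩
  · exact inferInstanceAs (Finite (H.E × (Fin n ⊕ Fin n)))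
  · rintro ⟨e, j⟩
    rw [comp_len hn, h.len]
  · intro x
    rcases exists_old_or_mid x with ⟨v, rfl⟩ | ⟨e, i, rfl⟩
    · obtain ⟨e, rfl | rfl⟩ := h.incident v
      · exact ⟨lower e ⟨0, hn⟩, .inl (src_lower _ _).symm⟩
      · exact ⟨upper e ⟨0, hn⟩, .inr (tgt_upper _ _).symm⟩
    · exact ⟨lower e i, .inr (tgt_lower _ _).symm⟩
  · intro p
    obtain ⟨e, i, rfl | rfl⟩ := exists_lower_or_upper p
    · rw [src_lower, tgt_lower, hmid, h.cut.self, h.edge]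
      simp
    · rw [src_upper, tgt_upper, hcut.symm, hmid, h.cut.self, h.cut.symm, h.edge]
      simp
  · intro p p' hpp
    obtain ⟨e, i, hp⟩ := exists_lower_or_upper p
    obtain ⟨e', j, hp'⟩ := exists_lower_or_upper p'
    by_cases hee : e = e'
    · subst hee
      by_cases hij : i = j
      · subst hij
        have hs := series_lower_upper hn (h.len e) h.cut (h.edge e) hcut hold (hmid e) i
        rcases hp with rfl | rfl <;> rcases hp' with rfl | rfl
        · exact absurd rfl hpp
        · exact .inl hs
        · exact .inr (.inl hs)
        · exact absurd rfl hpp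
      · exact .inr (.inr (parallel_of_same_edge hn (h.len e) h.cut (h.edge e) hcut hold (hmid e)
          (hsame e) hij hp hp'))
    · rcases h.pair e e' hee with hs | hs | hs
      · exact .inl (hs.comp hn (h.len e) (h.len e') hold (hleft e e' hee) (hright e') hp hp')
      · exact .inr (.inl (hs.comp hn (h.len e') (h.len e) hold (hleft e' e (Ne.symm hee))
          (hright e) hp' hp))
      · exact .inr (.inr (hs.comp hn (h.len e) (h.len e') hold (hleft e e' hee) (hright e')
          hp hp'))

theorem exists_isMonotoneCut_opow {m : ℕ} (hn : 1 ≤ n) (hm : 1 ≤ m) (hnm : n ≤ 2 * m) (k : ℕ) :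
    ∃ ℓ D, IsMonotoneCut ((K2 n).opow k) (m / (2 * m - 1)) ℓ D := by
  induction k with
  | zero => exact ⟨1, isMonotoneCut_singleEdge _⟩
  | succ k ih =>
    obtain ⟨ℓ, D, h⟩ := ih
    exact ⟨ℓ / 2, h.comp hn hm hnm⟩

end step

/-! ### Comparison with the shortest-path distance -/

namespace IsMonotoneCut

variable {G : STGraph} {θ : ℝ} {ℓ : ℝ≥0} {D : G.V → G.V → ℝ}

theorem ofReal_le_edist (h : IsMonotoneCut G θ ℓ D) (x y : G.V) :
    ENNReal.ofReal (D x y) ≤ edist x y := by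
  refine le_iInf₂ fun l hl => ?_
  rw [← ENNReal.ofReal_coe_nnreal]
  exact ENNReal.ofReal_le_ofReal (hl.semimetric_le h.cut.self h.cut.symm h.cut.triangle
    fun e => (h.edge e).trans_le (by rw [h.len]))

theorem within (h : IsMonotoneCut G θ ℓ D) (hθ : 1 / 2 < θ) (hθ1 : θ ≤ 1) (x y : G.V) :
    G.Within x y (D x y / (1 - 1 / (4 * θ))) := by
  have hc : 0 < 1 - 1 / (4 * θ) := by
    have : 1 / (4 * θ) < 1 := by
      rw [div_lt_one (by linarith)]
      linarith
    linarith
  have hc1 : 1 - 1 / (4 * θ) ≤ 1 := by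
    have : 0 < 1 / (4 * θ) := by positivity
    linarith
  have swap : ∀ {x y}, G.Within y x (D y x / (1 - 1 / (4 * θ))) →
      G.Within x y (D x y / (1 - 1 / (4 * θ))) := fun {x y} hw => by
    rw [h.cut.symm x y]; exact hw.symm
  have hser : ∀ {x y r}, G.SeriesAt D x y r → G.Within x y (D x y / (1 - 1 / (4 * θ))) :=
    fun hs => hs.within (h.cut.nonneg _ _) hc hc1
  have hseries : ∀ {e e'}, G.Series D ℓ e e' → ∀ {x y}, (x = G.src e ∨ x = G.tgt e) →
      (y = G.src e' ∨ y = G.tgt e') → G.Within x y (D x y / (1 - 1 / (4 * θ))) := by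
    rintro e e' ⟨r, h1, h2, h3, h4⟩ x y (rfl | rfl) (rfl | rfl)
    exacts [hser h2, hser h4, hser h1, hser h3]
  have hedge : ∀ e, G.SeriesAt D (G.src e) (G.tgt e) ℓ := fun e =>
    ⟨by simpa [h.len] using Within.edge e, h.edge e⟩
  have hself : ∀ x, G.SeriesAt D x x 0 := fun x => ⟨Within.refl x le_rfl, h.cut.self x⟩
  obtain ⟨e, hx⟩ := h.incident x
  obtain ⟨e', hy⟩ := h.incident y
  by_cases hee : e = e'
  · subst hee
    rcases hx with rfl | rfl <;> rcases hy with rfl | rfl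
    exacts [hser (hself _), hser (hedge e), swap (hser (hedge e)), hser (hself _)]
  · rcases h.pair e e' hee with hs | hs | hs
    · exact hseries hs hx hy
    · exact swap (hseries hs hy hx)
    · obtain ⟨L, α, β, δ, hL, -, ⟨ha0, ha1, ha2, -⟩, ⟨hb0, hb1, hb2, -⟩, h1, h2, h3, h4⟩ := hs
      rcases hx with rfl | rfl <;> rcases hy with rfl | rfl
      · exact h1.within hL hθ.le hθ1 ha0 (by linarith) hb0 (by linarith)
      · exact h2.within hL hθ.le hθ1 ha0 (by linarith) (by linarith) hb2
      · exact h3.within hL hθ.le hθ1 (by linarith) ha2 hb0 (by linarith)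
      · exact h4.within hL hθ.le hθ1 (by linarith) ha2 (by linarith) hb2

theorem pos_of_ne (h : IsMonotoneCut G θ ℓ D) (hθ : 1 / 2 < θ) (hθ1 : θ ≤ 1) {x y : G.V}
    (hxy : x ≠ y) : 0 < D x y := by
  obtain ⟨l, hl, hlD⟩ := h.within hθ hθ1 x y
  have hℓ : 0 < ℓ := h.pos
  have hl' : (0 : ℝ) < l := by exact_mod_cast hℓ.trans_le (hl.le_of_ne h.len hxy)
  by_contra hD
  rw [le_antisymm (not_lt.1 hD) (h.cut.nonneg x y), zero_div] at hlD
  linarith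

end IsMonotoneCut
end STGraph

/-! ### Cut metrics in `L₁` -/

/-- The unit interval is divided into `N` intervals of the length `1 / N`, one for each of the
`N` colourings. A vertex is mapped to the indicator function of the union of the intervals of those
colourings in which its colour is `true`. -/
theorem IsCutMetric.exists_L1 {V : Type} {D : V → V → ℝ} (h : IsCutMetric D) :
    ∃ f : V → L1, ∀ x y, edist (f x) (f y) = ENNReal.ofReal (D x y) := by
  classical
  obtain ⟨Ω, _, _, S, hS⟩ := h
  set N : ℕ := Fintype.card Ω with hN
  have hN0 : (0 : ℝ) < N := by exact_mod_cast Fintype.card_pos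
  let ι : Ω → ℕ := fun ω => (Fintype.equivFin Ω ω : ℕ)
  have hι : Function.Injective ι := fun a b hab =>
    (Fintype.equivFin Ω).injective (Fin.ext hab)
  have hιN : ∀ ω, ι ω < N := fun ω => (Fintype.equivFin Ω ω).2
  let μ : Measure ℝ := (volume : Measure ℝ).restrict (Set.Icc 0 1)
  let g : ℝ → ℕ := fun t => ⌊N * t⌋₊
  have hg : Measurable g := Nat.measurable_floor.comp (measurable_const_mul _)
  have hfibre : ∀ ω, μ (g ⁻¹' {ι ω}) = ENNReal.ofReal (1 / N) := by
    intro ω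
    have hset : g ⁻¹' {ι ω} ∩ Set.Icc 0 1 = Set.Ico ((ι ω : ℝ) / N) ((ι ω + 1 : ℝ) / N) := by
      ext t
      have hω : (ι ω + 1 : ℝ) ≤ N := by exact_mod_cast hιN ω
      simp only [Set.mem_inter_iff, Set.mem_preimage, Set.mem_singleton_iff, Set.mem_Icc,
        Set.mem_Ico, div_le_iff₀ hN0, lt_div_iff₀ hN0, g]
      constructor
      · rintro ⟨h1, h2, -⟩
        rw [Nat.floor_eq_iff (by positivity)] at h1
        exact ⟨by linarith, by linarith⟩
      · rintro ⟨h1, h2⟩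
        have h3 : 0 ≤ t := nonneg_of_mul_nonneg_left ((Nat.cast_nonneg _).trans h1) hN0
        refine ⟨?_, h3, ?_⟩
        · rw [Nat.floor_eq_iff (by positivity)]
          exact ⟨by linarith, by linarith⟩
        · have : t * N ≤ 1 * N := by linarith
          exact le_of_mul_le_mul_right this hN0
    rw [Measure.restrict_apply (hg (measurableSet_singleton _)), hset, Real.volume_Ico]
    congr 1
    ring
  let A : V → Set ℝ := fun x => g ⁻¹' (ι '' {ω | S ω x = true})
  have hA : ∀ x, MeasurableSet (A x) := fun x => hg (MeasurableSet.of_discrete)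
  refine ⟨fun x => indicatorConstLp 1 (hA x) (measure_ne_top μ _) 1, fun x y => ?_⟩
  have hsymm : symmDiff (A x) (A y) =
      g ⁻¹' ↑((Finset.univ.filter fun ω => S ω x ≠ S ω y).image ι) := by
    have h1 : symmDiff (A x) (A y) =
        g ⁻¹' symmDiff (ι '' {ω | S ω x = true}) (ι '' {ω | S ω y = true}) := rfl
    rw [h1, ← Set.image_symmDiff hι, Finset.coe_image]
    congr 2
    ext ω
    simp only [Set.mem_symmDiff, Set.mem_ofPred_eq, Finset.coe_filter, Finset.mem_univ, true_and]
    cases S ω x <;> cases S ω y <;> simp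
  rw [edist_indicatorConstLp_eq_enorm, ← ofReal_norm,
    norm_indicatorConstLp one_ne_zero ENNReal.one_ne_top, hS]
  congr 1
  have hμ : μ (symmDiff (A x) (A y)) =
      ∑ ω ∈ Finset.univ.filter fun ω => S ω x ≠ S ω y, ENNReal.ofReal (1 / N) := by
    rw [hsymm, ← sum_measure_preimage_singleton _ fun y _ => hg (measurableSet_singleton y),
      Finset.sum_image hι.injOn]
    exact Finset.sum_congr rfl fun ω _ => hfibre ω
  have hsum : ∑ ω, colourDist (S ω x) (S ω y) =
      (Finset.univ.filter fun ω => S ω x ≠ S ω y).card := by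
    rw [Finset.card_filter]
    push_cast
    refine Finset.sum_congr rfl fun ω _ => ?_
    by_cases h : S ω x = S ω y <;> simp [colourDist, h]
  change ‖(1 : ℝ)‖ * (μ (symmDiff (A x) (A y))).toReal ^ (1 / (1 : ℝ≥0∞).toReal) = _
  rw [hμ, hsum, Finset.sum_const, nsmul_eq_mul, ENNReal.toReal_mul,
    ENNReal.toReal_ofReal (by positivity)]
  simp
  rfl

/-- A semimetric of type `L₁` that lies between `1 / K` times the distance and the distance gives
an embedding of distortion at most `K`. -/
theorem IsCutMetric.c1_le {V : Type} [PseudoEMetricSpace V] {D : V → V → ℝ} (h : IsCutMetric D)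
    {K : ℝ} (hK : 0 ≤ K) (hpos : ∀ x y, x ≠ y → 0 < D x y)
    (hle : ∀ x y, ENNReal.ofReal (D x y) ≤ edist x y)
    (hge : ∀ x y, edist x y ≤ ENNReal.ofReal (K * D x y)) : c1 V ≤ ENNReal.ofReal K := by
  obtain ⟨f, hf⟩ := h.exists_L1
  have hinj : Function.Injective f := by
    intro x y hxy
    by_contra hne
    have h0 := hf x y
    rw [hxy, edist_self, eq_comm, ENNReal.ofReal_eq_zero] at h0
    exact absurd (hpos x y hne) (not_lt.2 h0)
  refine (iInf₂_le f hinj).trans ?_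
  have h1 : lipNorm f ≤ 1 := by
    refine iSup_le fun x => iSup_le fun y => iSup_le fun _ => ENNReal.div_le_of_le_mul ?_
    rw [one_mul, hf]
    exact hle x y
  have h2 : lipNorm (Equiv.ofInjective f hinj).symm ≤ ENNReal.ofReal K := by
    refine iSup_le fun a => iSup_le fun b => iSup_le fun _ => ENNReal.div_le_of_le_mul ?_
    obtain ⟨x, rfl⟩ := (Equiv.ofInjective f hinj).surjective a
    obtain ⟨y, rfl⟩ := (Equiv.ofInjective f hinj).surjective b
    rw [Equiv.symm_apply_apply, Equiv.symm_apply_apply]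
    change edist x y ≤ ENNReal.ofReal K * edist (f x) (f y)
    rw [hf, ← ENNReal.ofReal_mul hK]
    exact hge x y
  calc distortion f hinj ≤ 1 * ENNReal.ofReal K := mul_le_mul' h1 h2
    _ = _ := one_mul _

theorem theorem5p1 (n k : ℕ) (hn : 1 ≤ n) :
    c1 ((STGraph.K2 n).opow k).V ≤
      ENNReal.ofReal (2 - 2 / (2 * (⌈(n : ℝ) / 2⌉ : ℝ) + 1)) := by
  obtain ⟨m, hm⟩ : ∃ m : ℕ, m = (n + 1) / 2 := ⟨_, rfl⟩
  have hm1 : 1 ≤ m := by omega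
  have hnm : n ≤ 2 * m := by omega
  have hceil : ⌈(n : ℝ) / 2⌉ = (m : ℤ) := by
    rw [Int.ceil_eq_iff]
    have h1 : (n : ℝ) ≤ 2 * m := by exact_mod_cast hnm
    have h2 : (2 * m : ℝ) ≤ n + 1 := by exact_mod_cast (by omega : 2 * m ≤ n + 1)
    push_cast
    constructor <;> linarith
  have hmR : (1 : ℝ) ≤ m := by exact_mod_cast hm1
  obtain ⟨ℓ, D, h⟩ := STGraph.exists_isMonotoneCut_opow hn hm1 hnm k
  have h2m : (0 : ℝ) < 2 * m - 1 := by linarith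
  have hθ : (1 / 2 : ℝ) < m / (2 * m - 1) := by
    rw [lt_div_iff₀ h2m]; linarith
  have hθ1 : (m / (2 * m - 1) : ℝ) ≤ 1 := by
    rw [div_le_one h2m]; linarith
  have hc : (1 - 1 / (4 * (m / (2 * m - 1))) : ℝ) = (2 * m + 1) / (4 * m) := by
    field_simp
    ring
  have hK : (2 - 2 / (2 * ((m : ℤ) : ℝ) + 1) : ℝ) = 4 * m / (2 * m + 1) := by
    push_cast
    field_simp
    ring
  rw [hceil, hK]
  refine h.cut.c1_le (by positivity) (fun x y => h.pos_of_ne hθ hθ1) h.ofReal_le_edist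
    fun x y => ((h.within hθ hθ1 x y).mono (le_of_eq ?_)).edist_le
  rw [hc]
  field_simp
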